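/- Let $\mathbb X\subset\mathbb R^D$ be a Borel set with Lebesgue measure, let $p_\tau:\mathbb X\times\mathbb X\to[0,\infty)$ be a (jointly measurable) transition density, i.e. $\int_{\mathbb X}p_\tau(x,y)\,\mathrm dy=1$ for all $x\in\mathbb X$, and let $\rho_0$ be a probability density on $\mathbb X$. Let $(X_t,X_{t+\tau})$ have joint density $\rho(x,y)=\rho_0(x)p_\tau(x,y)$. Let $s$ be uniform on $[0,1]$ and let $X_t',X_{t+\tau}'$ be standard Gaussian vectors in $\mathbb R^D$, with $s$, $(X_t,X_{t+\tau})$ and the Gaussian vectors independent. Put $X_t^s=(1-s)X_t'+sX_t$ and $X_{t+\tau}^s=(1-s)X_{t+\tau}'+sX_{t+\tau}$. For Borel velocity fields $v_0,v_1:\mathbb R\times\mathbb R^D\times\mathbb X\to\mathbb R^D$ define $$\mathcal L[v_0,v_1]=\mathcal L_0[v_0]+\mathcal L_1[v_1],$$ $$\mathcal L_0[v]=\mathbb E\,\bigl\|v(s,X_{t+\tau}^s,X_t)-(X_{t+\tau}-X_{t+\tau}')\bigr\|^2,\qquad \mathcal L_1[v]=\mathbb E\,\bigl\|v(s,X_t^s,X_{t+\tau})-(X_t-X_t')\bigr\|^2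 ,$$ with values in $[0,\infty]$. Fix a measurable map $r:\mathbb X\to\mathbb R^d$ (the reaction coordinate; for instance a continuously differentiable one), and for Borel $v_0^{\mathrm{RC}},v_1^{\mathrm{RC}}:\mathbb R\times\mathbb R^D\times\mathbb R^d\to\mathbb R^D$ put $$\mathcal L^{\mathrm{FMRC}}[v_0^{\mathrm{RC}},v_1^{\mathrm{RC}},r]=\mathcal L_0\bigl[v_0^{\mathrm{RC}}(\cdot,\ast,r(\#))\bigr]+\mathcal L_1\bigl[v_1^{\mathrm{RC}}(\cdot,\ast,r(\#))\bigr].$$ The system is called lumpable with respect to $r$ if there is a measurable $p_\tau^L:\mathbb R^d\times\mathbb X\to[0,\infty)$ with $p_\tau(x,y)=p_\tau^L(r(x),y)$, and decomposable with respect to $r$ if there are measurable $p_\tau^D:\mathbb X\times\mathbb R^d\to[0,\infty)$ and $p_{\mathrm{local}}:\mathbb R^d\times\mathbb X\to[0,\infty)$ with $p_\tau(x,y)=p_\tau^D(x,r(y))\,p_{\mathrm{local}}(r(y),y)$; both identities between densities are meant for almost every $(x,y)$ with respect to $\rho_0(x)\,\mathrm dx\,\mathrm dy$ (that is, Lebesgue-almost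 everywhere if $\rho_0>0$). Then the minima of $\mathcal L$ and of $\mathcal L^{\mathrm{FMRC}}[\cdot,\cdot,r]$ are attained, and: 1. $\displaystyle\min_{v_0^{\mathrm{RC}},v_1^{\mathrm{RC}}}\mathcal L^{\mathrm{FMRC}}[v_0^{\mathrm{RC}},v_1^{\mathrm{RC}},r]\ \ge\ \min_{v_0,v_1}\mathcal L[v_0,v_1]$. 2. If $\min\mathcal L<\infty$ (for instance if $X_t$ and $X_{t+\tau}$ have finite second moments), equality holds in 1 if and only if the system is both lumpable and decomposable with respect to $r$. -/

import Mathlib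

open MeasureTheory ProbabilityTheory
open scoped NNReal ENNReal

namespace FMRC

/-- Euclidean space `ℝⁿ`. -/
abbrev E (n : ℕ) : Type := EuclideanSpace ℝ (Fin n)

/-- Lebesgue measure on a measurable set `X ⊆ ℝᴰ`, as a measure on the subtype. -/
noncomputable def leb {D : ℕ} (X : Set (E D)) : Measure X :=
  Measure.comap Subtype.val (volume : Measure (E D))

/-- `p` is a transition density on the state space `X ⊆ ℝᴰ` (with Lebesgue measure): for every
starting point `x`, the function `p x` is a probability density on `X`. -/
structure IsTransitionDensity {D : ℕ} {X : Set (E D)} (p : X → X → ℝ≥0) : Prop where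
  measurable : Measurable (fun q : X × X => p q.1 q.2)
  lintegral_eq_one : ∀ x : X, ∫⁻ y, (p x y : ℝ≥0∞) ∂(leb X) = 1

/-- `ρ₀` is a probability density on `X` with respect to Lebesgue measure. -/
structure IsProbDensity {D : ℕ} {X : Set (E D)} (ρ₀ : X → ℝ≥0) : Prop where
  measurable : Measurable ρ₀
  lintegral_eq_one : ∫⁻ x, (ρ₀ x : ℝ≥0∞) ∂(leb X) = 1

/-- The law of the pair `(X_t, X_{t+τ})`, with joint density `ρ(x, y) = ρ₀(x) p_τ(x, y)`. -/
noncomputable def jointLaw {D : ℕ} {X : Set (E D)} (p : X → X → ℝ≥0) (ρ₀ : X → ℝ≥0) :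
    Measure (X × X) :=
  ((leb X).prod (leb X)).withDensity (fun q => (ρ₀ q.1 : ℝ≥0∞) * (p q.1 q.2 : ℝ≥0∞))

/-- The linear interpolation `I(s; a, b) = (1 - s) a + s b`. -/
noncomputable def interp {D : ℕ} (s : ℝ) (a b : E D) : E D := (1 - s) • a + s • b

/-- The forward conditional flow-matching loss: `s` is uniform on `[0, 1]`, the pair
`q = (X_t, X_{t+τ})` has law `ρ`, and `w` is an independent standard Gaussian vector.
The conditioning variable is `X_t`. -/
noncomputable def loss₀ {D : ℕ} {X : Set (E D)} (p : X → X → ℝ≥0) (ρ₀ : X → ℝ≥0)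
    (v : ℝ × E D × X → E D) : ℝ≥0∞ :=
  ∫⁻ s in Set.Icc (0 : ℝ) 1, ∫⁻ q : X × X, ∫⁻ w : E D,
    ‖v (s, interp s w (q.2 : E D), q.1) - ((q.2 : E D) - w)‖ₑ ^ 2
      ∂(stdGaussian (E D)) ∂(jointLaw p ρ₀)

/-- The backward conditional flow-matching loss; the conditioning variable is `X_{t+τ}`. -/
noncomputable def loss₁ {D : ℕ} {X : Set (E D)} (p : X → X → ℝ≥0) (ρ₀ : X → ℝ≥0)
    (v : ℝ × E D × X → E D) : ℝ≥0∞ :=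
  ∫⁻ s in Set.Icc (0 : ℝ) 1, ∫⁻ q : X × X, ∫⁻ w : E D,
    ‖v (s, interp s w (q.1 : E D), q.2) - ((q.1 : E D) - w)‖ₑ ^ 2
      ∂(stdGaussian (E D)) ∂(jointLaw p ρ₀)

/-- The full loss `L[v₀, v₁] = L₀[v₀] + L₁[v₁]`. -/
noncomputable def fullLoss {D : ℕ} {X : Set (E D)} (p : X → X → ℝ≥0) (ρ₀ : X → ℝ≥0)
    (v₀ v₁ : ℝ × E D × X → E D) : ℝ≥0∞ :=
  loss₀ p ρ₀ v₀ + loss₁ p ρ₀ v₁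

/-- The bottlenecked velocity field `v(·, ∗, r(#))`. -/
def bottleneck {D d : ℕ} {X : Set (E D)} (r : X → E d) (v : ℝ × E D × E d → E D) :
    ℝ × E D × X → E D :=
  fun a => v (a.1, a.2.1, r a.2.2)

/-- The FMRC loss `L^FMRC[v₀, v₁, r] = L₀[v₀(·, ∗, r(#))] + L₁[v₁(·, ∗, r(#))]`. -/
noncomputable def fmrcLoss {D d : ℕ} {X : Set (E D)} (p : X → X → ℝ≥0) (ρ₀ : X → ℝ≥0)
    (r : X → E d) (v₀ v₁ : ℝ × E D × E d → E D) : ℝ≥0∞ :=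
  loss₀ p ρ₀ (bottleneck r v₀) + loss₁ p ρ₀ (bottleneck r v₁)

/-- All values of the full loss, over pairs of Borel velocity fields. -/
def fullLossValues {D : ℕ} {X : Set (E D)} (p : X → X → ℝ≥0) (ρ₀ : X → ℝ≥0) : Set ℝ≥0∞ :=
  {l | ∃ v₀ v₁ : ℝ × E D × X → E D, Measurable v₀ ∧ Measurable v₁ ∧ l = fullLoss p ρ₀ v₀ v₁}

/-- All values of the FMRC loss for the fixed reaction coordinate `r`, over pairs of Borel
velocity fields. -/
def fmrcLossValues {D d : ℕ} {X : Set (E D)} (p : X → X → ℝ≥0) (ρ₀ : X → ℝ≥0)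
    (r : X → E d) : Set ℝ≥0∞ :=
  {l | ∃ v₀ v₁ : ℝ × E D × E d → E D,
    Measurable v₀ ∧ Measurable v₁ ∧ l = fmrcLoss p ρ₀ r v₀ v₁}

/-- The measure `ρ₀(x) dx dy` on `X × X`. Identities between transition densities are meant up to
its null sets: for almost every `y` and almost every initial state `x`. If `ρ₀ > 0`, these are
the Lebesgue null sets. -/
noncomputable def refMeasure {D : ℕ} {X : Set (E D)} (ρ₀ : X → ℝ≥0) : Measure (X × X) :=
  ((leb X).withDensity (fun x => (ρ₀ x : ℝ≥0∞))).prod (leb X)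

/-- Lumpability: `p_τ(x, y) = p_L(r(x), y)`. -/
def Lumpable {D d : ℕ} {X : Set (E D)} (p : X → X → ℝ≥0) (ρ₀ : X → ℝ≥0) (r : X → E d) : Prop :=
  ∃ pL : E d × X → ℝ≥0, Measurable pL ∧
    ∀ᵐ q ∂(refMeasure ρ₀), p q.1 q.2 = pL (r q.1, q.2)

/-- Decomposability: `p_τ(x, y) = p_D(x, r(y)) p_local(r(y), y)`. -/
def Decomposable {D d : ℕ} {X : Set (E D)} (p : X → X → ℝ≥0) (ρ₀ : X → ℝ≥0) (r : X → E d) :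
    Prop :=
  ∃ (pD : X × E d → ℝ≥0) (pLocal : E d × X → ℝ≥0), Measurable pD ∧ Measurable pLocal ∧
    ∀ᵐ q ∂(refMeasure ρ₀), p q.1 q.2 = pD (q.1, r q.2) * pLocal (r q.2, q.2)

end FMRC

/-! Each loss is a least-squares regression. At a fixed time `0 < s < 1` and a fixed conditioning
value, write `z` for the interpolated point; the target `y - w` equals `(1 - s)⁻¹ • (y - z)`, so the
best predictor from `z` is its posterior mean, and any other field pays exactly its mean-square
distance to that one (`lintegral_velocity_loss_eq`, `condLoss_eq_add_condDist`). No moment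
assumption is needed for this: the Gaussian weight gives the posterior of `y` given `z` a finite
second moment.

A bottlenecked loss is the unrestricted loss for the law of `(r a, b)` (`condLoss_map_fst`), so it
too has a minimizer, built from the conditional kernel of that law. If the unrestricted minimum is
finite, the bottleneck is lossless exactly when the two optimal fields are at distance zero.

The crux is that the optimal field at a single interior time determines the target law
(`eq_of_flowVelocity_ae_eq`). Moving `z` tilts the posterior at `z = 0` by a linear functional, and
the mean of a tilt is the gradient of the cumulant generating function; hence the velocity
determines the moment generating function, then the posterior, then the prior. Losslessness
therefore means that the conditional law of the target depends on the conditioning variable only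
through `r`.

For laws with densities this is a factorization of the joint density. Conditioning on `X_t` it reads
as lumpability, conditioning on `X_{t+τ}` as decomposability (`lumpable_iff`, `decomposable_iff`).
-/

namespace FMRC

/-! ### Posteriors at a fixed time, and recovery of the target law from the velocity. -/

section Flow

open scoped RealInnerProductSpace

variable {V : Type*} [NormedAddCommGroup V] [InnerProductSpace ℝ V]

/-- Up to an additive constant, the logarithm of the conditional density at `z` of
`(1 - s) • w + s • y` given `y`, where `w` is a standard Gaussian vector. -/
noncomputable def logWeight (s : ℝ) (z y : V) : ℝ := -(‖(1 - s)⁻¹ • (z - s • y)‖ ^ 2 / 2)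

lemma logWeight_nonpos (s : ℝ) (z y : V) : logWeight s z y ≤ 0 := by
  unfold logWeight
  have := sq_nonneg ‖(1 - s)⁻¹ • (z - s • y)‖
  linarith

lemma exp_logWeight_le_one (s : ℝ) (z y : V) : Real.exp (logWeight s z y) ≤ 1 :=
  Real.exp_le_one_iff.2 (logWeight_nonpos s z y)

lemma continuous_logWeight (s : ℝ) : Continuous fun q : V × V => logWeight s q.1 q.2 := by
  unfold logWeight
  fun_prop

/-- Expanding the square leaves `z` and `y` coupled only by a term linear in `y`; this is why
changing `z` is an exponential tilt. -/
lemma logWeight_eq_add (s : ℝ) (z y : V) :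
    logWeight s z y = logWeight s 0 y + ⟪(((1 - s)⁻¹) ^ 2 * s) • z, y⟫
      + -(((1 - s)⁻¹) ^ 2 * ‖z‖ ^ 2 / 2) := by
  unfold logWeight
  simp only [norm_smul, mul_pow, zero_sub, norm_neg, norm_sub_sq_real, inner_smul_right,
    real_inner_smul_left, Real.norm_eq_abs, sq_abs]
  ring

/-- For `s > 0` the Gaussian weight decays in `y` and beats `‖y‖ ^ 2`. The bound is uniform in `y`,
so it gives posterior second moments for every prior, even one with no moments. -/
lemma exp_logWeight_mul_sq_le {s : ℝ} (hs0 : 0 < s) (hs1 : s < 1) (z y : V) :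
    Real.exp (logWeight s z y) * ‖y‖ ^ 2 ≤ 2 * (s⁻¹) ^ 2 * (2 * (1 - s) ^ 2 + ‖z‖ ^ 2) := by
  set t := ‖(1 - s)⁻¹ • (z - s • y)‖ with ht
  have h1s : (0 : ℝ) < 1 - s := by linarith
  have hnorm : ‖z - s • y‖ = (1 - s) * t := by
    rw [ht, norm_smul, Real.norm_eq_abs, abs_of_pos (inv_pos.2 h1s), ← mul_assoc,
      mul_inv_cancel₀ h1s.ne', one_mul]
  have hy : s * ‖y‖ ≤ (1 - s) * t + ‖z‖ := by
    have h2 : ‖s • y‖ ≤ ‖z - s • y‖ + ‖z‖ := by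
      have := norm_sub_le z (z - s • y)
      rw [sub_sub_cancel] at this
      linarith
    rwa [norm_smul, Real.norm_eq_abs, abs_of_pos hs0, hnorm] at h2
  have hy2 : s ^ 2 * ‖y‖ ^ 2 ≤ 2 * ((1 - s) ^ 2 * t ^ 2 + ‖z‖ ^ 2) := by
    have h0 : 0 ≤ s * ‖y‖ := by positivity
    nlinarith [sq_nonneg ((1 - s) * t - ‖z‖)]
  have he : Real.exp (logWeight s z y) * (t ^ 2) ≤ 2 := by
    have hw : logWeight s z y = -(t ^ 2 / 2) := rfl
    rw [hw, Real.exp_neg, inv_mul_le_iff₀ (Real.exp_pos _)]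
    have := Real.add_one_le_exp (t ^ 2 / 2)
    linarith
  have he1 := exp_logWeight_le_one s z y
  have he0 := (Real.exp_pos (logWeight s z y)).le
  have key : Real.exp (logWeight s z y) * (s ^ 2 * ‖y‖ ^ 2)
      ≤ 2 * (2 * (1 - s) ^ 2 + ‖z‖ ^ 2) := by
    calc Real.exp (logWeight s z y) * (s ^ 2 * ‖y‖ ^ 2)
        ≤ Real.exp (logWeight s z y) * (2 * ((1 - s) ^ 2 * t ^ 2 + ‖z‖ ^ 2)) := by gcongr
      _ = 2 * ((1 - s) ^ 2 * (Real.exp (logWeight s z y) * t ^ 2)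
            + Real.exp (logWeight s z y) * ‖z‖ ^ 2) := by ring
      _ ≤ 2 * ((1 - s) ^ 2 * 2 + 1 * ‖z‖ ^ 2) := by gcongr
      _ = _ := by ring
  calc Real.exp (logWeight s z y) * ‖y‖ ^ 2
      = (s⁻¹) ^ 2 * (Real.exp (logWeight s z y) * (s ^ 2 * ‖y‖ ^ 2)) := by field_simp
    _ ≤ (s⁻¹) ^ 2 * (2 * (2 * (1 - s) ^ 2 + ‖z‖ ^ 2)) := by gcongr
    _ = _ := by ring

/-- A dominating constant, locally uniform in `z`, for continuity of the posterior mean. -/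
lemma norm_exp_logWeight_smul_le {s : ℝ} (hs0 : 0 < s) (hs1 : s < 1) (z y : V) :
    ‖Real.exp (logWeight s z y) • y‖ ≤ 1 + 2 * (s⁻¹) ^ 2 * (2 * (1 - s) ^ 2 + ‖z‖ ^ 2) := by
  rw [norm_smul, Real.norm_eq_abs, abs_of_pos (Real.exp_pos _)]
  have h1 := exp_logWeight_mul_sq_le hs0 hs1 z y
  have he1 := exp_logWeight_le_one s z y
  have he0 := (Real.exp_pos (logWeight s z y)).le
  have h2 : ‖y‖ ≤ 1 + ‖y‖ ^ 2 := by nlinarith [norm_nonneg y, sq_nonneg (‖y‖ - 1)]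
  nlinarith [mul_le_mul_of_nonneg_left h2 he0]

variable [MeasurableSpace V]

/-- The conditional law of `y ∼ μ` given `(1 - s) • w + s • y = z`. -/
noncomputable def posterior (μ : Measure V) (s : ℝ) (z : V) : Measure V :=
  μ.tilted (logWeight s z)

/-- The flow-matching velocity field `z ↦ 𝔼[y - w | (1 - s) • w + s • y = z]` for `y ∼ μ`. -/
noncomputable def flowVelocity (μ : Measure V) (s : ℝ) (z : V) : V :=
  (1 - s)⁻¹ • (∫ y, y ∂(posterior μ s z) - z)

lemma integral_posterior (μ : Measure V) (s : ℝ) (z : V) :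
    ∫ y, y ∂(posterior μ s z)
      = (∫ y, Real.exp (logWeight s z y) ∂μ)⁻¹ • ∫ y, Real.exp (logWeight s z y) • y ∂μ := by
  rw [posterior, integral_tilted, ← integral_smul]
  congr with y
  rw [smul_smul, div_eq_inv_mul]

variable [BorelSpace V]

lemma integrable_exp_logWeight (μ : Measure V) [IsFiniteMeasure μ] (s : ℝ) (z : V) :
    Integrable (fun y => Real.exp (logWeight s z y)) μ := by
  have hc : Continuous fun y => Real.exp (logWeight s z y) := by
    have := continuous_logWeight (V := V) s
    fun_prop
  refine Integrable.of_bound hc.aestronglyMeasurable 1 (ae_of_all _ fun y => ?_)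
  rw [Real.norm_eq_abs, abs_of_pos (Real.exp_pos _)]
  exact exp_logWeight_le_one s z y

lemma isProbabilityMeasure_posterior (μ : Measure V) [IsFiniteMeasure μ] [NeZero μ] (s : ℝ)
    (z : V) : IsProbabilityMeasure (posterior μ s z) :=
  isProbabilityMeasure_tilted (integrable_exp_logWeight μ s z)

lemma integral_exp_logWeight_pos (μ : Measure V) [IsFiniteMeasure μ] [NeZero μ] (s : ℝ) (z : V) :
    0 < ∫ y, Real.exp (logWeight s z y) ∂μ :=
  integral_exp_pos (integrable_exp_logWeight μ s z)

/-- The part of the log-weight that depends on `z` alone disappears in the normalization, so only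
the linear functional remains. -/
lemma posterior_eq_tilted (μ : Measure V) [IsProbabilityMeasure μ] (s : ℝ) (z : V) :
    posterior μ s z
      = (posterior μ s 0).tilted fun y => ⟪(((1 - s)⁻¹) ^ 2 * s) • z, y⟫ := by
  set k := -(((1 - s)⁻¹) ^ 2 * ‖z‖ ^ 2 / 2) with hk
  set f : V → ℝ := logWeight s 0 + fun y : V => (⟪(((1 - s)⁻¹) ^ 2 * s) • z, y⟫ : ℝ) with hf
  have hfk : ∀ y, logWeight s z y = f y + k := fun y => logWeight_eq_add s z y
  have hint : Integrable (fun y => Real.exp (f y)) μ := by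
    have hsum : (fun y => Real.exp (f y)) = fun y => Real.exp (-k) *
        Real.exp (logWeight s z y) := by
      funext y
      rw [← Real.exp_add, hfk y]
      congr 1
      ring
    rw [hsum]
    exact (integrable_exp_logWeight μ s z).const_mul _
  have := isProbabilityMeasure_tilted hint
  rw [posterior, posterior, tilted_tilted (integrable_exp_logWeight μ s 0), ← hf,
    ← tilted_const (μ.tilted f) k, tilted_tilted hint]
  exact congrArg _ (funext hfk)

variable [FiniteDimensional ℝ V]

lemma memLp_two_posterior (μ : Measure V) [IsFiniteMeasure μ] {s : ℝ} (hs0 : 0 < s)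
    (hs1 : s < 1) (z : V) : MemLp (fun y => y) 2 (posterior μ s z) := by
  rw [memLp_two_iff_integrable_sq_norm (by fun_prop), posterior,
    integrable_tilted_iff (integrable_exp_logWeight μ s z)]
  have hc : Continuous fun y => Real.exp (logWeight s z y) • ‖y‖ ^ 2 := by
    have := continuous_logWeight (V := V) s
    fun_prop
  refine Integrable.of_bound hc.aestronglyMeasurable
    (2 * (s⁻¹) ^ 2 * (2 * (1 - s) ^ 2 + ‖z‖ ^ 2)) (ae_of_all _ fun y => ?_)
  rw [Real.norm_eq_abs, abs_of_nonneg (by positivity)]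
  exact exp_logWeight_mul_sq_le hs0 hs1 z y

/-- Continuity turns almost everywhere equality of velocities, which is all a loss can detect, into
equality at every point. -/
lemma continuous_flowVelocity (μ : Measure V) [IsFiniteMeasure μ] [NeZero μ] {s : ℝ}
    (hs0 : 0 < s) (hs1 : s < 1) : Continuous (flowVelocity μ s) := by
  have hcw := continuous_logWeight (V := V) s
  have h1 : Continuous fun z => ∫ y, Real.exp (logWeight s z y) ∂μ := by
    refine continuous_of_dominated (bound := fun _ => 1) (fun z => ?_) (fun z => ?_)
      (integrable_const _) (ae_of_all _ fun y => by fun_prop)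
    · exact (integrable_exp_logWeight μ s z).aestronglyMeasurable
    · refine ae_of_all _ fun y => ?_
      rw [Real.norm_eq_abs, abs_of_pos (Real.exp_pos _)]
      exact exp_logWeight_le_one s z y
  have h2 : Continuous fun z => ∫ y, Real.exp (logWeight s z y) • y ∂μ := by
    refine continuous_iff_continuousAt.2 fun z₀ => ?_
    refine continuousAt_of_dominated
      (bound := fun _ => 1 + 2 * (s⁻¹) ^ 2 * (2 * (1 - s) ^ 2 + (‖z₀‖ + 1) ^ 2))
      (Filter.Eventually.of_forall fun z => ?_) ?_ (integrable_const _)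
      (ae_of_all _ fun y => ?_)
    · exact Continuous.aestronglyMeasurable (by fun_prop)
    · filter_upwards [Metric.ball_mem_nhds z₀ one_pos] with z hz
      refine ae_of_all _ fun y => (norm_exp_logWeight_smul_le hs0 hs1 z y).trans ?_
      have : ‖z‖ ≤ ‖z₀‖ + 1 := by
        have h3 := norm_le_norm_add_norm_sub' z z₀
        rw [mem_ball_iff_norm] at hz
        linarith
      gcongr
    · exact Continuous.continuousAt (by fun_prop)
  unfold flowVelocity
  simp_rw [integral_posterior]
  exact (((h1.inv₀ fun z => (integral_exp_logWeight_pos μ s z).ne').smul h2).sub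
    continuous_id).const_smul _

/-- A probability measure with finite exponential moments is determined by the means of its
exponential tilts. -/
theorem eq_of_integral_tilted_inner_eq {μ ν : Measure V} [IsProbabilityMeasure μ]
    [IsProbabilityMeasure ν]
    (hμ : ∀ z : V, Integrable (fun y => Real.exp ⟪z, y⟫) μ)
    (hν : ∀ z : V, Integrable (fun y => Real.exp ⟪z, y⟫) ν)
    (hμ' : ∀ z : V, Integrable (fun y => y) (μ.tilted fun y => ⟪z, y⟫))
    (hν' : ∀ z : V, Integrable (fun y => y) (ν.tilted fun y => ⟪z, y⟫))
    (h : ∀ z : V, ∫ y, y ∂(μ.tilted fun y => ⟪z, y⟫) = ∫ y, y ∂(ν.tilted fun y => ⟪z, y⟫)) :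
    μ = ν := by
  refine Measure.ext_of_charFun (funext fun z => ?_)
  -- Along the line spanned by `z` the problem is one-dimensional: the derivative of the cumulant
  -- generating function of `X` at `t` is the `z`-component of the mean of the tilt by `t • z`.
  set X : V → ℝ := fun y => ⟪z, y⟫ with hX
  have hset : ∀ {η : Measure V}, (∀ z : V, Integrable (fun y => Real.exp ⟪z, y⟫) η) →
      integrableExpSet X η = Set.univ := by
    intro η hη
    refine Set.eq_univ_of_forall fun t => ?_
    have := hη (t • z)
    simpa [integrableExpSet, hX, real_inner_smul_left] using this
  have hμi : interior (integrableExpSet X μ) = Set.univ := by simp [hset hμ]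
  have hνi : interior (integrableExpSet X ν) = Set.univ := by simp [hset hν]
  have hdiff : ∀ {η : Measure V} [IsProbabilityMeasure η],
      interior (integrableExpSet X η) = Set.univ → Differentiable ℝ (cgf X η) := by
    intro η _ hη t
    exact (analyticAt_cgf (by simp [hη])).differentiableAt
  have hderiv : ∀ {η : Measure V}, interior (integrableExpSet X η) = Set.univ →
      (∀ z : V, Integrable (fun y => y) (η.tilted fun y => ⟪z, y⟫)) →
      ∀ t, deriv (cgf X η) t = ⟪z, ∫ y, y ∂(η.tilted fun y => ⟪t • z, y⟫)⟫ := by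
    intro η hη hη' t
    rw [← integral_tilted_mul_self (by simp [hη]), ← integral_inner (hη' _)]
    simp only [hX, real_inner_smul_left]
  have hcgf : cgf X μ = cgf X ν := by
    -- Equal derivatives suffice, since both functions vanish at `0`.
    refine eq_of_fderiv_eq (𝕜 := ℝ) (hdiff hμi) (hdiff hνi) (fun t => ?_) 0 (by simp)
    ext
    simp only [fderiv_eq_smul_deriv, one_smul, hderiv hμi hμ', hderiv hνi hν', h]
  have hmgf : mgf X μ = mgf X ν := by
    funext t
    have h1 : Integrable (fun y => Real.exp (t * X y)) μ := by
      have : t ∈ integrableExpSet X μ := by simp [hset hμ]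
      exact this
    have h2 : Integrable (fun y => Real.exp (t * X y)) ν := by
      have : t ∈ integrableExpSet X ν := by simp [hset hν]
      exact this
    rw [← exp_cgf h1, ← exp_cgf h2, hcgf]
  -- By analytic continuation the complex moment generating functions agree too; at `Complex.I` they
  -- are the characteristic functions at `z`.
  have hc := eqOn_complexMGF_of_mgf hmgf (x := Complex.I) (by simp [hμi])
  simp only [complexMGF, hX] at hc
  simp only [charFun_apply]
  convert hc using 4 <;> rw [real_inner_comm, mul_comm]

/-- The velocity field at a single interior time determines the target distribution. -/
theorem eq_of_flowVelocity_ae_eq {μ ν : Measure V} [IsProbabilityMeasure μ]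
    [IsProbabilityMeasure ν] {s : ℝ} (hs0 : 0 < s) (hs1 : s < 1)
    (h : flowVelocity μ s =ᵐ[volume] flowVelocity ν s) : μ = ν := by
  have hv : flowVelocity μ s = flowVelocity ν s :=
    Continuous.ae_eq_iff_eq volume (continuous_flowVelocity μ hs0 hs1)
      (continuous_flowVelocity ν hs0 hs1) |>.1 h
  have h1s : (1 - s)⁻¹ ≠ 0 := inv_ne_zero (by linarith)
  set c := ((1 - s)⁻¹) ^ 2 * s with hc
  have hc0 : c ≠ 0 := mul_ne_zero (pow_ne_zero _ h1s) hs0.ne'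
  -- As `c ≠ 0`, which uses `s ≠ 0`, every linear tilt of the posterior at `0` is a posterior at
  -- some point.
  have hpost : ∀ (η : Measure V) [IsProbabilityMeasure η] (z : V),
      (posterior η s 0).tilted (fun y => ⟪z, y⟫) = posterior η s (c⁻¹ • z) := by
    intro η _ z
    rw [posterior_eq_tilted η s (c⁻¹ • z), ← hc, smul_smul, mul_inv_cancel₀ hc0, one_smul]
  have hexp : ∀ (η : Measure V) [IsProbabilityMeasure η] (z : V),
      Integrable (fun y => Real.exp ⟪z, y⟫) (posterior η s 0) := by
    intro η _ z
    -- A tilt by a function with non-integrable exponential is the zero measure by convention,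
    -- whereas this tilt is a posterior, hence a probability measure.
    by_contra hcon
    have h1 := hpost η z
    rw [tilted_of_not_integrable hcon] at h1
    have := isProbabilityMeasure_posterior η s (c⁻¹ • z)
    exact IsProbabilityMeasure.ne_zero (posterior η s (c⁻¹ • z)) h1.symm
  have hint : ∀ (η : Measure V) [IsProbabilityMeasure η] (z : V),
      Integrable (fun y => y) ((posterior η s 0).tilted fun y => ⟪z, y⟫) := by
    intro η _ z
    have := isProbabilityMeasure_posterior η s (c⁻¹ • z)
    rw [hpost]
    exact (memLp_two_posterior η hs0 hs1 _).integrable one_le_two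
  have := isProbabilityMeasure_posterior μ s 0
  have := isProbabilityMeasure_posterior ν s 0
  have key : posterior μ s 0 = posterior ν s 0 := by
    refine eq_of_integral_tilted_inner_eq (hexp μ) (hexp ν) (hint μ) (hint ν) fun z => ?_
    rw [hpost, hpost]
    have := congrFun hv (c⁻¹ • z)
    unfold flowVelocity at this
    exact sub_left_injective (smul_right_injective V h1s this)
  -- Tilting back by the negated log-weight recovers the prior from the posterior.
  rw [← tilted_neg_same (integrable_exp_logWeight μ s 0),
    ← tilted_neg_same (integrable_exp_logWeight ν s 0)]
  exact congrArg (fun η => Measure.tilted η _) key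

end Flow
-- Gaussian change of variables and the bias-variance splitting of the loss at a fixed time.
section Gaussian

open scoped RealInnerProductSpace

variable {V : Type*} [NormedAddCommGroup V] [InnerProductSpace ℝ V]

/-- Eliminates the noise: given the interpolated point, the regression target is an affine function
of `y` alone. -/
lemma interp_velocity_eq {s : ℝ} (hs1 : s ≠ 1) (w y : V) :
    y - w = (1 - s)⁻¹ • (y - ((1 - s) • w + s • y)) := by
  have h1s : (1 - s) ≠ 0 := sub_ne_zero.2 hs1.symm
  have : y - ((1 - s) • w + s • y) = (1 - s) • (y - w) := by module
  rw [this, smul_smul, inv_mul_cancel₀ h1s, one_smul]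

/-- Bias-variance decomposition with respect to a probability measure. -/
lemma lintegral_enorm_sub_sq_eq [FiniteDimensional ℝ V] {Ω : Type*} [MeasurableSpace Ω]
    {η : Measure Ω} [IsProbabilityMeasure η] {f : Ω → V} (hf : MemLp f 2 η) (a : V) :
    ∫⁻ ω, ‖a - f ω‖ₑ ^ 2 ∂η
      = ∫⁻ ω, ‖(∫ ω, f ω ∂η) - f ω‖ₑ ^ 2 ∂η + ‖a - ∫ ω, f ω ∂η‖ₑ ^ 2 := by
  set m := ∫ ω, f ω ∂η with hm
  have hsq : ∀ b : V, MemLp (fun ω => b - f ω) 2 η := fun b => (memLp_const b).sub hf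
  have hsqi : ∀ b : V, Integrable (fun ω => ‖b - f ω‖ ^ 2) η := fun b => (hsq b).norm.integrable_sq
  have hconv : ∀ b : V, ∫⁻ ω, ‖b - f ω‖ₑ ^ 2 ∂η = ENNReal.ofReal (∫ ω, ‖b - f ω‖ ^ 2 ∂η) := by
    intro b
    rw [ofReal_integral_eq_lintegral_ofReal (hsqi b) (ae_of_all _ fun ω => by positivity)]
    congr with ω
    rw [ENNReal.ofReal_pow (norm_nonneg _), ofReal_norm]
  rw [hconv, hconv, ← ofReal_norm, ← ENNReal.ofReal_pow (norm_nonneg _),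
    ← ENNReal.ofReal_add (integral_nonneg fun ω => by positivity) (by positivity)]
  congr 1
  have hexp : ∀ ω, ‖a - f ω‖ ^ 2 = ‖m - f ω‖ ^ 2 + 2 * ⟪a - m, m - f ω⟫ + ‖a - m‖ ^ 2 := by
    intro ω
    have : a - f ω = (m - f ω) + (a - m) := by abel
    rw [this, norm_add_sq_real, real_inner_comm]
  have hfi : Integrable f η := hf.integrable one_le_two
  have hmi : Integrable (fun ω => m - f ω) η := (integrable_const m).sub hfi
  have hin : Integrable (fun ω => 2 * ⟪a - m, m - f ω⟫) η := (hmi.const_inner _).const_mul 2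
  have hzero : ∫ ω, 2 * ⟪a - m, m - f ω⟫ ∂η = 0 := by
    rw [integral_const_mul, integral_inner hmi, integral_sub (integrable_const m) hfi]
    simp [← hm]
  simp_rw [hexp]
  rw [integral_add (f := fun ω => ‖m - f ω‖ ^ 2 + 2 * ⟪a - m, m - f ω⟫)
    ((hsqi m).add hin) (integrable_const _), integral_add (hsqi m) hin, hzero]
  simp

variable [MeasurableSpace V] [BorelSpace V] [FiniteDimensional ℝ V]

variable (V) in
/-- The standard Gaussian measure has a density proportional to `exp (-‖w‖² / 2)`. -/
theorem exists_stdGaussian_eq_withDensity : ∃ c : ℝ, 0 < c ∧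
    stdGaussian V
      = (volume : Measure V).withDensity
          fun w => ENNReal.ofReal (c * Real.exp (-(‖w‖ ^ 2 / 2))) := by
  have hre : (0 : ℝ) < ((1 / 2 : ℝ) : ℂ).re := by norm_num
  set d : ℂ := (Module.finrank ℝ V / 2 : ℂ)
  set J : ℝ := ∫ w : V, Real.exp (-(‖w‖ ^ 2 / 2)) with hJdef
  have hfun : (fun w : V => Real.exp (-(‖w‖ ^ 2 / 2)))
      = fun w => Real.exp (-(1 / 2 : ℝ) * ‖w‖ ^ 2) := by
    funext w; congr 1; ring
  have hJpos : 0 < J := by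
    rw [hJdef, hfun, GaussianFourier.integral_rexp_neg_mul_sq_norm (by norm_num)]
    positivity
  -- A non-integrable function has integral `0` by convention, so positivity of `J` already gives
  -- integrability.
  have hint : Integrable (fun w : V => Real.exp (-(‖w‖ ^ 2 / 2))) := by
    by_contra hcon
    exact hJpos.ne' (integral_undef hcon)
  refine ⟨J⁻¹, inv_pos.2 hJpos, ?_⟩
  have hmeas : Measurable fun w : V => J⁻¹ * Real.exp (-(‖w‖ ^ 2 / 2)) := by fun_prop
  have hfin : IsFiniteMeasure ((volume : Measure V).withDensity
      fun w => ENNReal.ofReal (J⁻¹ * Real.exp (-(‖w‖ ^ 2 / 2)))) :=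
    isFiniteMeasure_withDensity_ofReal (hint.const_mul _).2
  have hJC : (J : ℂ) = (Real.pi / ((1 / 2 : ℝ) : ℂ)) ^ d := by
    rw [← GaussianFourier.integral_cexp_neg_mul_sq_norm (V := V) hre, hJdef, hfun,
      ← integral_complex_ofReal]
    congr with w
    push_cast
    rfl
  refine Measure.ext_of_charFun (funext fun t => ?_)
  rw [charFun_stdGaussian, charFun_apply, integral_withDensity_eq_integral_toReal_smul
    (by fun_prop) (by simp)]
  have hstep : ∀ w : V, (ENNReal.ofReal (J⁻¹ * Real.exp (-(‖w‖ ^ 2 / 2)))).toReal •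
      Complex.exp (⟪w, t⟫ * Complex.I)
      = (J : ℂ)⁻¹ * Complex.exp (-((1 / 2 : ℝ) : ℂ) * ‖w‖ ^ 2 + Complex.I * ⟪t, w⟫) := by
    intro w
    rw [ENNReal.toReal_ofReal (by positivity), Complex.exp_add, real_inner_comm, Complex.real_smul]
    push_cast
    rw [mul_comm Complex.I]
    ring_nf
  simp_rw [hstep]
  rw [integral_const_mul, GaussianFourier.integral_cexp_neg_mul_sq_norm_add hre, ← mul_assoc,
    ← hJC, inv_mul_cancel₀ (by exact_mod_cast hJpos.ne'), one_mul]
  congr 1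
  rw [Complex.I_sq]
  push_cast
  ring

/-- Change of variables from the Gaussian source to the interpolated point. -/
lemma exists_lintegral_interp_stdGaussian {s : ℝ} (hs1 : s ≠ 1) : ∃ C : ℝ, 0 < C ∧
    ∀ (y : V) (F : V → ℝ≥0∞), Measurable F →
      ∫⁻ w, F ((1 - s) • w + s • y) ∂(stdGaussian V)
        = ∫⁻ z, ENNReal.ofReal (C * Real.exp (logWeight s z y)) * F z := by
  obtain ⟨c, hc, hγ⟩ := exists_stdGaussian_eq_withDensity V
  have h1s : (1 - s) ≠ 0 := sub_ne_zero.2 hs1.symm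
  -- The Jacobian of `w ↦ (1 - s) • w`; the shift by `s • y` preserves Lebesgue measure. Neither
  -- factor of the constant depends on `y`.
  set a : ℝ := |((1 - s) ^ Module.finrank ℝ V)⁻¹| with ha
  have ha0 : 0 < a := by positivity
  refine ⟨a * c, by positivity, fun y F hF => ?_⟩
  have hcw := continuous_logWeight (V := V) s
  rw [hγ, lintegral_withDensity_eq_lintegral_mul _ (by fun_prop) (by fun_prop)]
  set H : V → ℝ≥0∞ := fun z => ENNReal.ofReal (c * Real.exp (logWeight s z y)) * F z with hH
  have hHm : Measurable H := by fun_prop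
  have h1 : ∀ w : V, ENNReal.ofReal (c * Real.exp (-(‖w‖ ^ 2 / 2))) * F ((1 - s) • w + s • y)
      = H ((1 - s) • w + s • y) := by
    intro w
    simp only [hH, logWeight, add_sub_cancel_right, smul_smul, inv_mul_cancel₀ h1s,
      one_smul]
  simp_rw [Pi.mul_apply, h1]
  calc ∫⁻ w, H ((1 - s) • w + s • y)
      = ∫⁻ w, (fun z => H (z + s • y)) w ∂(Measure.map (fun w : V => (1 - s) • w) volume) := by
        rw [lintegral_map (by fun_prop) (by fun_prop)]
    _ = ENNReal.ofReal a * ∫⁻ z, H (z + s • y) := by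
        rw [Measure.map_addHaar_smul _ h1s, lintegral_smul_measure, smul_eq_mul]
    _ = ENNReal.ofReal a * ∫⁻ z, H z := by rw [lintegral_add_right_eq_self]
    _ = _ := by
        rw [← lintegral_const_mul _ hHm]
        congr with z
        rw [hH, ← mul_assoc, ← ENNReal.ofReal_mul ha0.le, mul_assoc a]

/-- Tonelli's theorem for the interpolated point, in terms of the posterior. -/
lemma exists_lintegral_interp (μ : Measure V) [IsFiniteMeasure μ] [NeZero μ] {s : ℝ}
    (hs1 : s ≠ 1) : ∃ f : V → ℝ≥0∞, (∀ z, f z ≠ 0) ∧ Measurable f ∧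
      ∀ F : V × V → ℝ≥0∞, Measurable F →
      ∫⁻ y, ∫⁻ w, F ((1 - s) • w + s • y, y) ∂(stdGaussian V) ∂μ
        = ∫⁻ z, f z * ∫⁻ y, F (z, y) ∂(posterior μ s z) := by
  obtain ⟨C, hC, h⟩ := exists_lintegral_interp_stdGaussian (V := V) hs1
  have hcw := continuous_logWeight (V := V) s
  have hI : ∀ z, 0 < ∫ y, Real.exp (logWeight s z y) ∂μ := integral_exp_logWeight_pos μ s
  -- The Lebesgue density of the interpolated point: the constant times the normalizer of the
  -- posterior, hence positive everywhere.
  refine ⟨fun z => ENNReal.ofReal (C * ∫ y, Real.exp (logWeight s z y) ∂μ), fun z => ?_, ?_,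
    fun F hF => ?_⟩
  · exact (ENNReal.ofReal_pos.2 (mul_pos hC (hI z))).ne'
  · have : StronglyMeasurable fun z => ∫ y, Real.exp (logWeight s z y) ∂μ :=
      StronglyMeasurable.integral_prod_right'
        (f := fun (q : V × V) => Real.exp (logWeight s q.1 q.2))
        (Continuous.stronglyMeasurable (by fun_prop))
    exact (this.measurable.const_mul C).ennreal_ofReal
  have hFy : ∀ y, ∫⁻ w, F ((1 - s) • w + s • y, y) ∂(stdGaussian V)
      = ∫⁻ z, ENNReal.ofReal (C * Real.exp (logWeight s z y)) * F (z, y) := fun y =>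
    h y (fun z => F (z, y)) (by fun_prop)
  simp_rw [hFy]
  have hm : Measurable fun q : V × V =>
    ENNReal.ofReal (C * Real.exp (logWeight s q.2 q.1)) * F (q.2, q.1) := by fun_prop
  rw [lintegral_lintegral_swap hm.aemeasurable]
  congr with z
  have hFz : Measurable fun y => F (z, y) := by fun_prop
  have hwz : Measurable fun y => Real.exp (logWeight s z y) :=
    Continuous.measurable (by fun_prop)
  rw [posterior, lintegral_tilted, ← lintegral_const_mul _ (by fun_prop)]
  congr with y
  rw [← mul_assoc, ← ENNReal.ofReal_mul (mul_pos hC (hI z)).le]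
  have hIz := (hI z).ne'
  congr 2
  field_simp

/-- The flow-matching loss at a fixed time splits into its value at the flow velocity and the
mean-square distance to it. -/
theorem lintegral_velocity_loss_eq (μ : Measure V) [IsProbabilityMeasure μ] {s : ℝ} (hs0 : 0 < s)
    (hs1 : s < 1) {v : V → V} (hv : Measurable v) :
    ∫⁻ y, ∫⁻ w, ‖v ((1 - s) • w + s • y) - (y - w)‖ₑ ^ 2 ∂(stdGaussian V) ∂μ
      = ∫⁻ y, ∫⁻ w, ‖flowVelocity μ s ((1 - s) • w + s • y) - (y - w)‖ₑ ^ 2 ∂(stdGaussian V) ∂μ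
        + ∫⁻ y, ∫⁻ w, ‖v ((1 - s) • w + s • y) - flowVelocity μ s ((1 - s) • w + s • y)‖ₑ ^ 2
          ∂(stdGaussian V) ∂μ := by
  obtain ⟨f, -, hf, h⟩ := exists_lintegral_interp μ hs1.ne
  have hfv : Measurable (flowVelocity μ s) := (continuous_flowVelocity μ hs0 hs1).measurable
  have hgen : ∀ u : V → V, Measurable u →
      ∫⁻ y, ∫⁻ w, ‖u ((1 - s) • w + s • y) - (y - w)‖ₑ ^ 2 ∂(stdGaussian V) ∂μ
        = ∫⁻ z, f z * ∫⁻ y, ‖u z - (1 - s)⁻¹ • (y - z)‖ₑ ^ 2 ∂(posterior μ s z) := by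
    intro u hu
    rw [← h (fun q => ‖u q.1 - (1 - s)⁻¹ • (q.2 - q.1)‖ₑ ^ 2) (by fun_prop)]
    simp_rw [← interp_velocity_eq hs1.ne]
  rw [hgen v hv, hgen _ hfv, h (fun q => ‖v q.1 - flowVelocity μ s q.1‖ₑ ^ 2) (by fun_prop),
    ← lintegral_add_right]
  · congr with z
    have := isProbabilityMeasure_posterior μ s z
    have hL := memLp_two_posterior μ hs0 hs1 z
    have hL' : MemLp (fun y => (1 - s)⁻¹ • (y - z)) 2 (posterior μ s z) :=
      (hL.sub (memLp_const z)).const_smul _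
    have hmean : ∫ y, (1 - s)⁻¹ • (y - z) ∂(posterior μ s z) = flowVelocity μ s z := by
      rw [integral_smul, integral_sub (hL.integrable one_le_two) (integrable_const z)]
      simp [flowVelocity]
    rw [lintegral_enorm_sub_sq_eq hL' (v z), hmean, mul_add]
    simp
  · have hsimp : ∀ z, ∫⁻ _, ‖v z - flowVelocity μ s z‖ₑ ^ 2 ∂(posterior μ s z)
        = ‖v z - flowVelocity μ s z‖ₑ ^ 2 := by
      intro z
      have := isProbabilityMeasure_posterior μ s z
      simp
    simp_rw [hsimp]
    fun_prop

/-- The Gaussian noise gives the interpolated point an everywhere positive density, so zero distance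
along the interpolation is agreement up to Lebesgue null sets, whatever `μ` is. -/
lemma ae_eq_of_lintegral_interp_eq_zero (μ : Measure V) [IsProbabilityMeasure μ] {s : ℝ}
    (hs1 : s ≠ 1) {u v : V → V} (hu : Measurable u) (hv : Measurable v)
    (h0 : ∫⁻ y, ∫⁻ w, ‖v ((1 - s) • w + s • y) - u ((1 - s) • w + s • y)‖ₑ ^ 2
      ∂(stdGaussian V) ∂μ = 0) : v =ᵐ[volume] u := by
  obtain ⟨f, hf0, hf, h⟩ := exists_lintegral_interp μ hs1
  rw [h (fun q => ‖v q.1 - u q.1‖ₑ ^ 2) (by fun_prop)] at h0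
  have hsimp : ∀ z, ∫⁻ _, ‖v z - u z‖ₑ ^ 2 ∂(posterior μ s z) = ‖v z - u z‖ₑ ^ 2 := by
    intro z
    have := isProbabilityMeasure_posterior μ s z
    simp
  simp_rw [hsimp] at h0
  rw [lintegral_eq_zero_iff (by fun_prop)] at h0
  filter_upwards [h0] with z hz
  simpa [hf0 z, sub_eq_zero] using hz

end Gaussian
-- Conditional losses, their minimizers, and the cost of a bottleneck.
section Conditional

variable {V : Type*} [NormedAddCommGroup V] [InnerProductSpace ℝ V] [MeasurableSpace V]
  [BorelSpace V] [FiniteDimensional ℝ V]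
variable {A B U : Type*} [MeasurableSpace A] [MeasurableSpace B] [MeasurableSpace U]

/-- The conditional flow-matching loss of `v` for a pair `(a, b) ∼ ρ`: the target is `ι b` and the
conditioning variable is `a`. -/
noncomputable def condLoss (ι : B → V) (ρ : Measure (A × B)) (v : ℝ × V × A → V) : ℝ≥0∞ :=
  ∫⁻ s in Set.Icc (0 : ℝ) 1, ∫⁻ q, ∫⁻ w,
    ‖v (s, (1 - s) • w + s • ι q.2, q.1) - (ι q.2 - w)‖ₑ ^ 2 ∂(stdGaussian V) ∂ρ

/-- The mean-square distance of two velocity fields along the conditional interpolation. -/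
noncomputable def condDist (ι : B → V) (ρ : Measure (A × B)) (u v : ℝ × V × A → V) : ℝ≥0∞ :=
  ∫⁻ s in Set.Icc (0 : ℝ) 1, ∫⁻ q, ∫⁻ w,
    ‖v (s, (1 - s) • w + s • ι q.2, q.1) - u (s, (1 - s) • w + s • ι q.2, q.1)‖ₑ ^ 2
      ∂(stdGaussian V) ∂ρ

/-- The conditional flow velocity for targets with conditional law `κ`. -/
noncomputable def condVelocity (ι : B → V) (κ : Kernel A B) (x : ℝ × V × A) : V :=
  flowVelocity ((κ x.2.2).map ι) x.1 x.2.1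

lemma measurable_condVelocity {ι : B → V} (hι : Measurable ι) (κ : Kernel A B)
    [IsMarkovKernel κ] : Measurable (condVelocity ι κ) := by
  have hlw : Measurable fun q : (ℝ × V × A) × V => Real.exp (logWeight q.1.1 q.1.2.1 q.2) := by
    unfold logWeight
    fun_prop
  set η : Kernel (ℝ × V × A) V := (κ.map ι).comap (fun x => x.2.2) (by fun_prop) with hη
  have : IsMarkovKernel (κ.map ι) := Kernel.IsMarkovKernel.map κ hι
  have h1 : StronglyMeasurable fun x : ℝ × V × A =>
      ∫ y, Real.exp (logWeight x.1 x.2.1 y) ∂(η x) :=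
    StronglyMeasurable.integral_kernel_prod_right' (κ := η)
      (f := fun q : (ℝ × V × A) × V => Real.exp (logWeight q.1.1 q.1.2.1 q.2))
      hlw.stronglyMeasurable
  have h2 : StronglyMeasurable fun x : ℝ × V × A =>
      ∫ y, Real.exp (logWeight x.1 x.2.1 y) • y ∂(η x) :=
    StronglyMeasurable.integral_kernel_prod_right' (κ := η)
      (f := fun q : (ℝ × V × A) × V => Real.exp (logWeight q.1.1 q.1.2.1 q.2) • q.2)
      (hlw.smul measurable_snd).stronglyMeasurable
  have heq : condVelocity ι κ = fun x => (1 - x.1)⁻¹ •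
      ((∫ y, Real.exp (logWeight x.1 x.2.1 y) ∂(η x))⁻¹ •
        (∫ y, Real.exp (logWeight x.1 x.2.1 y) • y ∂(η x)) - x.2.1) := by
    funext x
    rw [condVelocity, flowVelocity, integral_posterior, hη, Kernel.comap_apply,
      Kernel.map_apply _ hι]
  rw [heq]
  have h1 := h1.measurable
  have h2 := h2.measurable
  fun_prop

lemma measurable_condLoss_integrand {ι : B → V} (hι : Measurable ι) {v : ℝ × V × A → V}
    (hv : Measurable v) : Measurable fun x : (ℝ × A × B) × V =>
      ‖v (x.1.1, (1 - x.1.1) • x.2 + x.1.1 • ι x.1.2.2, x.1.2.1) - (ι x.1.2.2 - x.2)‖ₑ ^ 2 := by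
  fun_prop

lemma measurable_condDist_integrand {ι : B → V} (hι : Measurable ι) {u v : ℝ × V × A → V}
    (hu : Measurable u) (hv : Measurable v) : Measurable fun x : (ℝ × A × B) × V =>
      ‖v (x.1.1, (1 - x.1.1) • x.2 + x.1.1 • ι x.1.2.2, x.1.2.1)
        - u (x.1.1, (1 - x.1.1) • x.2 + x.1.1 • ι x.1.2.2, x.1.2.1)‖ₑ ^ 2 := by
  fun_prop

lemma lintegral_compProd_lintegral_stdGaussian (π : Measure A) [SFinite π] (κ : Kernel A B)
    [IsSFiniteKernel κ] {F : (ℝ × A × B) × V → ℝ≥0∞} (hF : Measurable F) (s : ℝ) :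
    ∫⁻ q, ∫⁻ w, F ((s, q), w) ∂(stdGaussian V) ∂(π ⊗ₘ κ)
      = ∫⁻ a, ∫⁻ b, ∫⁻ w, F ((s, a, b), w) ∂(stdGaussian V) ∂(κ a) ∂π := by
  have h := hF.lintegral_prod_right' (ν := stdGaussian V)
  exact Measure.lintegral_compProd (f := fun q => ∫⁻ w, F ((s, q), w) ∂(stdGaussian V))
    (h.comp (measurable_const.prodMk measurable_id))

lemma measurable_lintegral_kernel_lintegral_stdGaussian (κ : Kernel A B)
    [IsSFiniteKernel κ] {F : (ℝ × A × B) × V → ℝ≥0∞} (hF : Measurable F) :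
    Measurable fun x : ℝ × A =>
      ∫⁻ b, ∫⁻ w, F ((x.1, x.2, b), w) ∂(stdGaussian V) ∂(κ x.2) := by
  have h := hF.lintegral_prod_right' (ν := stdGaussian V)
  exact Measurable.lintegral_kernel_prod_right' (κ := κ.comap Prod.snd measurable_snd)
    (f := fun x : (ℝ × A) × B => ∫⁻ w, F ((x.1.1, x.1.2, x.2), w) ∂(stdGaussian V))
    (h.comp (f := fun x : (ℝ × A) × B => (x.1.1, x.1.2, x.2)) (by fun_prop))

/-- The endpoints are degenerate: at `s = 0` the interpolated point carries no information on the
target, and at `s = 1` the noise is gone. -/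
lemma ae_restrict_Icc_mem_Ioo :
    ∀ᵐ s ∂((volume : Measure ℝ).restrict (Set.Icc 0 1)), s ∈ Set.Ioo (0 : ℝ) 1 := by
  rw [← restrict_Ioo_eq_restrict_Icc]
  exact ae_restrict_mem measurableSet_Ioo

/-- The splitting at a fixed time, applied to the target law `(κ a).map ι` for each `a` and
integrated over `a` and `s`. It holds in `[0, ∞]`, so no finiteness is assumed. -/
theorem condLoss_eq_add_condDist {ι : B → V} (hι : Measurable ι) (π : Measure A) [SFinite π]
    (κ : Kernel A B) [IsMarkovKernel κ] {v : ℝ × V × A → V} (hv : Measurable v) :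
    condLoss ι (π ⊗ₘ κ) v
      = condLoss ι (π ⊗ₘ κ) (condVelocity ι κ) + condDist ι (π ⊗ₘ κ) (condVelocity ι κ) v := by
  have hcv := measurable_condVelocity hι κ
  have hF := measurable_condLoss_integrand hι hv
  have hG := measurable_condLoss_integrand hι hcv
  have hH := measurable_condDist_integrand hι hcv hv
  have hGm := measurable_lintegral_kernel_lintegral_stdGaussian κ hG
  rw [condLoss, condLoss, condDist]
  simp_rw [lintegral_compProd_lintegral_stdGaussian π κ hF,
    lintegral_compProd_lintegral_stdGaussian π κ hG,
    lintegral_compProd_lintegral_stdGaussian π κ hH]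
  rw [← lintegral_add_left (Measurable.lintegral_prod_right' hGm)]
  refine lintegral_congr_ae ?_
  filter_upwards [ae_restrict_Icc_mem_Ioo] with s hs
  refine Eq.trans (lintegral_congr fun a => ?_)
    (lintegral_add_left (hGm.comp (measurable_prodMk_left (x := s))) _)
  have : IsProbabilityMeasure ((κ a).map ι) := Measure.isProbabilityMeasure_map hι.aemeasurable
  have hfv : Measurable (flowVelocity ((κ a).map ι) s) :=
    (continuous_flowVelocity _ hs.1 hs.2).measurable
  have hva : Measurable fun z => v (s, z, a) := by fun_prop
  have key := lintegral_velocity_loss_eq ((κ a).map ι) hs.1 hs.2 hva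
  rwa [lintegral_map (Measurable.lintegral_prod_right' (f := fun q : V × V =>
      ‖v (s, (1 - s) • q.2 + s • q.1, a) - (q.1 - q.2)‖ₑ ^ 2) (by fun_prop)) hι,
    lintegral_map (Measurable.lintegral_prod_right' (f := fun q : V × V =>
      ‖flowVelocity ((κ a).map ι) s ((1 - s) • q.2 + s • q.1) - (q.1 - q.2)‖ₑ ^ 2)
        (by fun_prop)) hι,
    lintegral_map (Measurable.lintegral_prod_right' (f := fun q : V × V =>
      ‖v (s, (1 - s) • q.2 + s • q.1, a)
        - flowVelocity ((κ a).map ι) s ((1 - s) • q.2 + s • q.1)‖ₑ ^ 2) (by fun_prop)) hι] at key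

/-- Zero distance makes the two velocities agree at almost every time. One interior time is enough
to identify the pushed-forward laws, and the embedding `ι` loses nothing. -/
lemma condDist_condVelocity_eq_zero_iff {ι : B → V} (hι : MeasurableEmbedding ι) (π : Measure A)
    [SFinite π] (κ : Kernel A B) [IsMarkovKernel κ] {r : A → U} (hr : Measurable r)
    (κ' : Kernel U B) [IsMarkovKernel κ'] :
    condDist ι (π ⊗ₘ κ) (condVelocity ι κ) (fun x => condVelocity ι κ' (x.1, x.2.1, r x.2.2)) = 0
      ↔ ∀ᵐ a ∂π, κ a = κ' (r a) := by
  have hcv := measurable_condVelocity hι.measurable κ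
  have hcv' := measurable_condVelocity hι.measurable κ'
  have hv : Measurable fun x : ℝ × V × A => condVelocity ι κ' (x.1, x.2.1, r x.2.2) := by
    fun_prop
  have hH := measurable_condDist_integrand hι.measurable hcv hv
  have hHm := measurable_lintegral_kernel_lintegral_stdGaussian κ hH
  have hprob : ∀ a, IsProbabilityMeasure ((κ a).map ι) := fun a =>
    Measure.isProbabilityMeasure_map hι.measurable.aemeasurable
  have hprob' : ∀ a, IsProbabilityMeasure ((κ' a).map ι) := fun a =>
    Measure.isProbabilityMeasure_map hι.measurable.aemeasurable
  rw [condDist]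
  simp_rw [lintegral_compProd_lintegral_stdGaussian π κ hH]
  constructor
  · intro h0
    rw [lintegral_eq_zero_iff (Measurable.lintegral_prod_right' hHm)] at h0
    have hne : NeZero ((volume : Measure ℝ).restrict (Set.Icc 0 1)) :=
      ⟨by simp [Measure.restrict_eq_zero]⟩
    obtain ⟨s, hs0, hs⟩ := (h0.and ae_restrict_Icc_mem_Ioo).exists
    have hsm := hHm.comp (measurable_prodMk_left (x := s))
    have h1 := (lintegral_eq_zero_iff hsm).1 hs0
    filter_upwards [h1] with a ha
    have := hprob a
    have := hprob' (r a)
    have hfv := (continuous_flowVelocity ((κ a).map ι) hs.1 hs.2).measurable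
    have hfv' := (continuous_flowVelocity ((κ' (r a)).map ι) hs.1 hs.2).measurable
    have hmap : (κ' (r a)).map ι = (κ a).map ι := by
      refine eq_of_flowVelocity_ae_eq hs.1 hs.2
        (ae_eq_of_lintegral_interp_eq_zero ((κ a).map ι) hs.2.ne hfv hfv' ?_)
      rw [lintegral_map (Measurable.lintegral_prod_right' (f := fun q : V × V =>
        ‖flowVelocity ((κ' (r a)).map ι) s ((1 - s) • q.2 + s • q.1)
          - flowVelocity ((κ a).map ι) s ((1 - s) • q.2 + s • q.1)‖ₑ ^ 2)
          (by fun_prop)) hι.measurable]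
      exact ha
    rw [← hι.comap_map (κ a), ← hι.comap_map (κ' (r a)), hmap]
  · intro h
    refine (lintegral_congr fun s => ?_).trans lintegral_zero
    refine (lintegral_congr_ae ?_).trans lintegral_zero
    filter_upwards [h] with a ha
    simp [condVelocity, ha]

/-- Reduces minimization under the bottleneck to unrestricted minimization for the law of `(r a,
b)`. -/
lemma condLoss_map_fst {ι : B → V} (hι : Measurable ι) (ρ : Measure (A × B)) {r : A → U}
    (hr : Measurable r) {v : ℝ × V × U → V} (hv : Measurable v) :
    condLoss ι (ρ.map (Prod.map r id)) v = condLoss ι ρ fun x => v (x.1, x.2.1, r x.2.2) := by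
  have hF := (measurable_condLoss_integrand hι hv).lintegral_prod_right' (ν := stdGaussian V)
  refine lintegral_congr fun s => ?_
  exact lintegral_map (hF.comp (f := fun q : U × B => (s, q)) (by fun_prop)) (by fun_prop)

variable [StandardBorelSpace B] [Nonempty B]

/-- The conditional law of the second coordinate given the first depends on the first coordinate
only through `r`. -/
def CondFactorsThrough (ρ : Measure (A × B)) [IsFiniteMeasure ρ] (r : A → U) : Prop :=
  ∃ K : Kernel U B, IsFiniteKernel K ∧ ∀ᵐ a ∂ρ.fst, ρ.condKernel a = K (r a)

/-- Any kernel `K` witnessing the factorization also disintegrates the law of `(r a, b)`, so by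
uniqueness it is the conditional kernel of that law, the one behind the bottlenecked minimizer. -/
lemma CondFactorsThrough.condKernel_ae_eq {ρ : Measure (A × B)} [IsFiniteMeasure ρ] {r : A → U}
    (hr : Measurable r) (h : CondFactorsThrough ρ r) :
    ∀ᵐ a ∂ρ.fst, ρ.condKernel a = (ρ.map (Prod.map r id)).condKernel (r a) := by
  obtain ⟨K, hK, h⟩ := h
  have hfst : (ρ.map (Prod.map r id)).fst = ρ.fst.map r := by
    rw [Measure.fst, Measure.fst, Measure.map_map (by fun_prop) (by fun_prop),
      Measure.map_map (by fun_prop) (by fun_prop)]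
    rfl
  have hdis : ρ.map (Prod.map r id) = (ρ.map (Prod.map r id)).fst ⊗ₘ K := by
    rw [hfst]
    refine Measure.ext_of_lintegral _ fun f hf => ?_
    rw [lintegral_map hf (by fun_prop), Measure.lintegral_compProd hf,
      lintegral_map (Measurable.lintegral_kernel_prod_right' hf) hr]
    conv_lhs => rw [← ρ.disintegrate ρ.condKernel]
    rw [Measure.lintegral_compProd (by fun_prop)]
    refine lintegral_congr_ae ?_
    filter_upwards [h] with a ha
    rw [ha]
    rfl
  have huniq := eq_condKernel_of_measure_eq_compProd K hdis
  rw [hfst] at huniq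
  filter_upwards [h, ae_of_ae_map hr.aemeasurable huniq] with a h1 h2
  rw [h1, h2]

/-- Minimizers of the conditional flow-matching loss, with and without the bottleneck `r`, and the
characterization of when the bottleneck is lossless. -/
theorem exists_condLoss_minimizers {ι : B → V} (hι : MeasurableEmbedding ι) (ρ : Measure (A × B))
    [IsProbabilityMeasure ρ] {r : A → U} (hr : Measurable r) :
    ∃ (v : ℝ × V × A → V) (u : ℝ × V × U → V), Measurable v ∧ Measurable u ∧
      (∀ v', Measurable v' → condLoss ι ρ v ≤ condLoss ι ρ v') ∧
      (∀ u', Measurable u' → condLoss ι ρ (fun x => u (x.1, x.2.1, r x.2.2))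
        ≤ condLoss ι ρ fun x => u' (x.1, x.2.1, r x.2.2)) ∧
      (condLoss ι ρ v < ∞ → (condLoss ι ρ (fun x => u (x.1, x.2.1, r x.2.2)) = condLoss ι ρ v ↔
        CondFactorsThrough ρ r)) := by
  have : IsProbabilityMeasure (ρ.map (Prod.map r (id : B → B))) :=
    Measure.isProbabilityMeasure_map (by fun_prop)
  set κ := ρ.condKernel with hκ
  set κ' := (ρ.map (Prod.map r id)).condKernel with hκ'
  have hu := measurable_condVelocity hι.measurable κ'
  have hru : Measurable fun x : ℝ × V × A => condVelocity ι κ' (x.1, x.2.1, r x.2.2) := by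
    fun_prop
  have hsplit : ∀ {v : ℝ × V × A → V}, Measurable v → condLoss ι ρ v
      = condLoss ι ρ (condVelocity ι κ) + condDist ι ρ (condVelocity ι κ) v := by
    intro v hv
    have := condLoss_eq_add_condDist hι.measurable ρ.fst κ hv
    rwa [hκ, ρ.disintegrate ρ.condKernel] at this
  have hsplit' : ∀ {v : ℝ × V × U → V}, Measurable v → condLoss ι (ρ.map (Prod.map r id)) v
      = condLoss ι (ρ.map (Prod.map r id)) (condVelocity ι κ')
        + condDist ι (ρ.map (Prod.map r id)) (condVelocity ι κ') v := by
    intro v hv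
    have := condLoss_eq_add_condDist hι.measurable (ρ.map (Prod.map r id)).fst κ' hv
    rwa [hκ', Measure.disintegrate] at this
  refine ⟨condVelocity ι κ, condVelocity ι κ', measurable_condVelocity hι.measurable κ, hu,
    fun v hv => ?_, fun u' hu' => ?_, fun hfin => ?_⟩
  · rw [hsplit hv]
    exact le_self_add
  · rw [← condLoss_map_fst hι.measurable ρ hr hu, ← condLoss_map_fst hι.measurable ρ hr hu',
      hsplit' hu']
    exact le_self_add
  · have hiff := condDist_condVelocity_eq_zero_iff hι ρ.fst κ hr κ'
    rw [hκ, ρ.disintegrate ρ.condKernel, ← hκ] at hiff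
    -- Cancellation in `[0, ∞]`; this is where finiteness of the minimum enters.
    have hzero : ∀ x : ℝ≥0∞, condLoss ι ρ (condVelocity ι κ) + x = condLoss ι ρ (condVelocity ι κ)
        ↔ x = 0 := fun x =>
      ⟨fun h => (ENNReal.add_right_inj hfin.ne).1 (h.trans (add_zero _).symm),
        fun h => by rw [h, add_zero]⟩
    rw [hsplit hru, hzero, hiff]
    exact ⟨fun h => ⟨κ', inferInstance, h⟩, fun h => h.condKernel_ae_eq hr⟩

end Conditional
-- Conditional laws depending only on `r`, expressed by densities.
section Density

variable {A B U : Type*} [MeasurableSpace A] [MeasurableSpace B] [MeasurableSpace U]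

lemma fst_withDensity_prod {α : Measure A} {β : Measure B} [SFinite α] [SFinite β]
    {g : A × B → ℝ≥0∞} (hg : Measurable g) :
    ((α.prod β).withDensity g).fst = α.withDensity fun a => ∫⁻ b, g (a, b) ∂β := by
  refine Measure.ext_of_lintegral _ fun f hf => ?_
  rw [Measure.fst, lintegral_map hf measurable_fst,
    lintegral_withDensity_eq_lintegral_mul _ hg (by fun_prop),
    lintegral_withDensity_eq_lintegral_mul _ hg.lintegral_prod_right' hf,
    lintegral_prod _ (by fun_prop)]
  refine lintegral_congr fun a => ?_
  simp only [Pi.mul_apply]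
  rw [lintegral_mul_const _ (by fun_prop)]

variable [StandardBorelSpace B] [Nonempty B]

/-- If a joint density factors as `c(a) f(r(a), b)`, the conditional law of `b` given `a` is
the normalization of `f (r a, ·)`. -/
theorem condKernel_ae_eq_of_density_eq {α : Measure A} {β : Measure B} [SFinite α] [SFinite β]
    {g : A × B → ℝ≥0∞} (hg : Measurable g) [IsFiniteMeasure ((α.prod β).withDensity g)]
    {r : A → U} (hr : Measurable r) {c : A → ℝ≥0∞} {f : U × B → ℝ≥0∞} (hf : Measurable f)
    (hgf : ∀ᵐ q ∂(α.prod β), g q = c q.1 * f (r q.1, q.2)) :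
    ∃ K : Kernel U B, IsFiniteKernel K ∧
      (∀ u, K u = β.withDensity fun b => f (u, b) / ∫⁻ b, f (u, b) ∂β) ∧
      ∀ᵐ a ∂((α.prod β).withDensity g).fst, ((α.prod β).withDensity g).condKernel a = K (r a) := by
  have hZ : Measurable fun u => ∫⁻ b, f (u, b) ∂β := hf.lintegral_prod_right'
  have hf' : Measurable (Function.uncurry fun u b => f (u, b) / ∫⁻ b, f (u, b) ∂β) := by
    change Measurable fun q : U × B => f (q.1, q.2) / ∫⁻ b, f (q.1, b) ∂β
    fun_prop
  set K : Kernel U B := (Kernel.const U β).withDensity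
    (fun u b => f (u, b) / ∫⁻ b, f (u, b) ∂β) with hKdef
  have hKa : ∀ u, K u = β.withDensity fun b => f (u, b) / ∫⁻ b, f (u, b) ∂β := by
    intro u
    rw [hKdef, Kernel.withDensity_apply _ hf', Kernel.const_apply]
  -- Where the normalizer is `0` or `∞` the quotient gives the zero measure, so the fibres have mass
  -- at most one and `K` need not be Markov.
  have hKfin : IsFiniteKernel K := by
    refine ⟨1, ENNReal.one_lt_top, fun u => ?_⟩
    rw [hKa, withDensity_apply _ MeasurableSet.univ, Measure.restrict_univ]
    simp_rw [div_eq_mul_inv]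
    rw [lintegral_mul_const _ (by fun_prop), ← div_eq_mul_inv]
    exact ENNReal.div_self_le_one
  refine ⟨K, hKfin, hKa, ?_⟩
  set ρ := (α.prod β).withDensity g with hρ
  have hfin : ∀ᵐ a ∂α, ∫⁻ b, g (a, b) ∂β < ∞ := by
    refine ae_lt_top hg.lintegral_prod_right' ?_
    rw [← lintegral_prod _ hg.aemeasurable, ← setLIntegral_univ,
      ← withDensity_apply _ MeasurableSet.univ]
    exact measure_ne_top _ _
  have hkey : ∀ᵐ a ∂α, ∀ᵐ b ∂β,
      g (a, b) = (∫⁻ b, g (a, b) ∂β) * (f (r a, b) / ∫⁻ b, f (r a, b) ∂β) := by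
    filter_upwards [Measure.ae_ae_of_ae_prod hgf, hfin] with a ha hfa
    have hm : ∫⁻ b, g (a, b) ∂β = c a * ∫⁻ b, f (r a, b) ∂β := by
      rw [← lintegral_const_mul _ (by fun_prop)]
      exact lintegral_congr_ae ha
    -- The degenerate normalizers are harmless: if it is `0`, then `f (r a, ·)` vanishes almost
    -- everywhere; if it is `∞`, finiteness of the marginal forces `c a = 0`. Either way `g (a, ·)`
    -- is null.
    by_cases h0 : ∫⁻ b, f (r a, b) ∂β = 0
    · rw [lintegral_eq_zero_iff (by fun_prop)] at h0
      filter_upwards [ha, h0] with b hb hb0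
      simp only [Pi.zero_apply] at hb0
      simp [hb, hb0]
    · by_cases htop : ∫⁻ b, f (r a, b) ∂β = ∞
      · have hc : c a = 0 := by
          by_contra hc
          rw [hm, htop, ENNReal.mul_top hc] at hfa
          exact lt_irrefl _ hfa
        filter_upwards [ha] with b hb
        simp [hb, hm, hc]
      · filter_upwards [ha] with b hb
        rw [hb, hm, mul_assoc, ENNReal.mul_div_cancel h0 htop]
  have hdis : ρ = ρ.fst ⊗ₘ (K.comap r hr) := by
    refine Measure.ext_of_lintegral _ fun F hF => ?_
    rw [Measure.lintegral_compProd hF, hρ, fst_withDensity_prod hg,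
      lintegral_withDensity_eq_lintegral_mul _ hg hF,
      lintegral_withDensity_eq_lintegral_mul _ hg.lintegral_prod_right'
        (Measurable.lintegral_kernel_prod_right' hF), lintegral_prod _ (by fun_prop)]
    refine lintegral_congr_ae ?_
    filter_upwards [hkey] with a ha
    simp only [Pi.mul_apply, Kernel.comap_apply, hKa]
    rw [lintegral_withDensity_eq_lintegral_mul _ (by fun_prop) (by fun_prop),
      ← lintegral_const_mul _ (by fun_prop)]
    refine lintegral_congr_ae ?_
    filter_upwards [ha] with b hb
    conv_lhs => rw [hb]
    simp only [Pi.mul_apply, mul_assoc]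
  filter_upwards [eq_condKernel_of_measure_eq_compProd _ hdis] with a ha
  rw [← ha, Kernel.comap_apply]

lemma condFactorsThrough_of_density_eq {α : Measure A} {β : Measure B} [SFinite α] [SFinite β]
    {g : A × B → ℝ≥0∞} (hg : Measurable g) [IsFiniteMeasure ((α.prod β).withDensity g)]
    {r : A → U} (hr : Measurable r) {c : A → ℝ≥0∞} {f : U × B → ℝ≥0∞} (hf : Measurable f)
    (hgf : ∀ᵐ q ∂(α.prod β), g q = c q.1 * f (r q.1, q.2)) :
    CondFactorsThrough ((α.prod β).withDensity g) r := by
  obtain ⟨K, hK, -, h⟩ := condKernel_ae_eq_of_density_eq hg hr hf hgf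
  exact ⟨K, hK, h⟩

/-- If the conditional law of `b` given `a` depends on `a` only through `r`, the joint density is
the product of the marginal density of `a` and a function of `(r a, b)`. -/
theorem CondFactorsThrough.exists_density_eq {α : Measure A} {β : Measure B} [SFinite α]
    [SigmaFinite β] {g : A × B → ℝ≥0∞} (hg : Measurable g) (hgfin : ∀ q, g q ≠ ∞)
    [IsFiniteMeasure ((α.prod β).withDensity g)] {r : A → U} (hr : Measurable r)
    (h : CondFactorsThrough ((α.prod β).withDensity g) r) :
    ∃ f : U × B → ℝ≥0, Measurable f ∧
      ∀ᵐ q ∂(α.prod β), g q = (∫⁻ b, g (q.1, b) ∂β) * f (r q.1, q.2) := by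
  obtain ⟨K, hK, hcond⟩ := h
  -- With the identity in place of `r`, this says that the conditional law given `a` is the
  -- normalized slice `g (a, ·)`.
  obtain ⟨K', -, hK', hcond'⟩ := condKernel_ae_eq_of_density_eq (α := α) (β := β) hg measurable_id
    (c := fun _ => 1) (f := g) hg (ae_of_all _ fun q => by simp)
  -- A density of `K u` with respect to `β` that is jointly measurable in `(u, b)`. It passes
  -- through the equivalent finite measure `β.toFinite`, so that the kernel derivative is taken
  -- between finite kernels.
  set k : U → B → ℝ≥0∞ := fun u b => Kernel.rnDeriv K (Kernel.const U β.toFinite) u b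
    * β.toFinite.rnDeriv β b with hk
  have hkm : Measurable fun q : U × B => k q.1 q.2 :=
    (Kernel.measurable_rnDeriv K (Kernel.const U β.toFinite)).mul
      ((Measure.measurable_rnDeriv _ _).comp measurable_snd)
  have hm : Measurable fun a => ∫⁻ b, g (a, b) ∂β := hg.lintegral_prod_right'
  have hfin : ∀ᵐ a ∂α, ∫⁻ b, g (a, b) ∂β < ∞ := by
    refine ae_lt_top hm ?_
    rw [← lintegral_prod _ hg.aemeasurable, ← setLIntegral_univ,
      ← withDensity_apply _ MeasurableSet.univ]
    exact measure_ne_top _ _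
  refine ⟨fun q => (k q.1 q.2).toNNReal, hkm.ennreal_toNNReal, ?_⟩
  rw [fst_withDensity_prod hg, ae_withDensity_iff hm] at hcond hcond'
  have hmeas : MeasurableSet {q : A × B | g q = (∫⁻ b, g (q.1, b) ∂β) *
      ((k (r q.1) q.2).toNNReal : ℝ≥0∞)} := by
    refine measurableSet_eq_fun hg ((hm.comp measurable_fst).mul ?_)
    exact ((hkm.comp (f := fun q : A × B => (r q.1, q.2))
      (by fun_prop)).ennreal_toNNReal).coe_nnreal_ennreal
  rw [Measure.ae_prod_iff_ae_ae hmeas]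
  filter_upwards [hcond, hcond', hfin] with a ha ha' hfa
  by_cases h0 : ∫⁻ b, g (a, b) ∂β = 0
  · have h0' := h0
    rw [lintegral_eq_zero_iff (by fun_prop)] at h0'
    filter_upwards [h0'] with b hb
    rw [h0, zero_mul, hb, Pi.zero_apply]
  have hKr : K (r a) = β.withDensity fun b => g (a, b) / ∫⁻ b, g (a, b) ∂β := by
    rw [← ha h0, ha' h0, hK', id]
  have hac : K (r a) ≪ β.toFinite :=
    hKr ▸ (withDensity_absolutelyContinuous _ _).trans (absolutelyContinuous_toFinite β)
  have hKk : K (r a) = β.withDensity (k (r a)) := by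
    have h1 : (Kernel.const U β.toFinite).withDensity
        (Kernel.rnDeriv K (Kernel.const U β.toFinite)) (r a) = K (r a) :=
      Kernel.withDensity_rnDeriv_eq (by simpa using hac)
    rw [Kernel.withDensity_apply _ (Kernel.measurable_rnDeriv _ _), Kernel.const_apply] at h1
    have h2 := Measure.withDensity_rnDeriv_eq β.toFinite β (toFinite_absolutelyContinuous β)
    have h3 : k (r a) = β.toFinite.rnDeriv β
        * Kernel.rnDeriv K (Kernel.const U β.toFinite) (r a) := by
      funext b
      simp [hk, mul_comm]
    rw [h3, withDensity_mul _ (Measure.measurable_rnDeriv _ _)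
      (Kernel.measurable_rnDeriv_right _ _ _), h2, h1]
  have hkr : Measurable (k (r a)) := hkm.comp (measurable_prodMk_left (x := r a))
  rw [hKr, withDensity_eq_iff_of_sigmaFinite (by fun_prop) hkr.aemeasurable] at hKk
  filter_upwards [hKk] with b hb
  have hne : k (r a) b ≠ ∞ := by
    rw [← hb]
    exact ENNReal.div_ne_top (hgfin _) h0
  rw [ENNReal.coe_toNNReal hne, ← hb, ENNReal.mul_div_cancel h0 hfa.ne]

end Density
-- Lumpability and decomposability as factorization of the two conditional laws.
section Main

variable {D d : ℕ} {X : Set (E D)}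

lemma sigmaFinite_leb (hX : MeasurableSet X) : SigmaFinite (leb X) := by
  have h : SigmaFinite ((leb X).map Subtype.val) := by
    rw [leb, (MeasurableEmbedding.subtype_coe hX).map_comap, Subtype.range_coe]
    infer_instance
  exact SigmaFinite.of_map _ measurable_subtype_coe.aemeasurable h

variable {p : X → X → ℝ≥0} {ρ₀ : X → ℝ≥0}

/-- The joint density `ρ(x, y) = ρ₀(x) p_τ(x, y)`. -/
noncomputable def jointDensity (p : X → X → ℝ≥0) (ρ₀ : X → ℝ≥0) (q : X × X) : ℝ≥0∞ :=
  (ρ₀ q.1 : ℝ≥0∞) * (p q.1 q.2 : ℝ≥0∞)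

lemma measurable_jointDensity (hp : IsTransitionDensity p) (hρ₀ : IsProbDensity ρ₀) :
    Measurable (jointDensity p ρ₀) :=
  (hρ₀.measurable.comp measurable_fst).coe_nnreal_ennreal.mul hp.measurable.coe_nnreal_ennreal

lemma jointDensity_ne_top (q : X × X) : jointDensity p ρ₀ q ≠ ∞ :=
  ENNReal.mul_ne_top ENNReal.coe_ne_top ENNReal.coe_ne_top

lemma lintegral_jointDensity (hp : IsTransitionDensity p) (x : X) :
    ∫⁻ y, jointDensity p ρ₀ (x, y) ∂(leb X) = ρ₀ x := by
  have hpx : Measurable (p x) := hp.measurable.comp measurable_prodMk_left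
  simp only [jointDensity]
  rw [lintegral_const_mul _ hpx.coe_nnreal_ennreal, hp.lintegral_eq_one, mul_one]

lemma isProbabilityMeasure_jointLaw [SigmaFinite (leb X)] (hp : IsTransitionDensity p)
    (hρ₀ : IsProbDensity ρ₀) : IsProbabilityMeasure (jointLaw p ρ₀) := by
  constructor
  have hg := measurable_jointDensity hp hρ₀
  change ((leb X).prod (leb X)).withDensity (jointDensity p ρ₀) Set.univ = 1
  rw [withDensity_apply _ MeasurableSet.univ, setLIntegral_univ, lintegral_prod _ hg.aemeasurable]
  simp_rw [lintegral_jointDensity hp]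
  exact hρ₀.lintegral_eq_one

/-- The law of `(X_{t+τ}, X_t)`. -/
noncomputable def reversedLaw (p : X → X → ℝ≥0) (ρ₀ : X → ℝ≥0) : Measure (X × X) :=
  ((leb X).prod (leb X)).withDensity fun q => jointDensity p ρ₀ q.swap

lemma map_swap_jointLaw [SigmaFinite (leb X)] (hp : IsTransitionDensity p)
    (hρ₀ : IsProbDensity ρ₀) : (jointLaw p ρ₀).map Prod.swap = reversedLaw p ρ₀ := by
  have hg := measurable_jointDensity hp hρ₀
  refine Measure.ext_of_lintegral _ fun f hf => ?_
  rw [lintegral_map hf measurable_swap, reversedLaw,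
    lintegral_withDensity_eq_lintegral_mul _ (by fun_prop) hf]
  change ∫⁻ q, f q.swap ∂(((leb X).prod (leb X)).withDensity (jointDensity p ρ₀)) = _
  rw [lintegral_withDensity_eq_lintegral_mul _ hg (by fun_prop), ← lintegral_prod_swap]
  rfl

lemma isProbabilityMeasure_reversedLaw [SigmaFinite (leb X)] (hp : IsTransitionDensity p)
    (hρ₀ : IsProbDensity ρ₀) : IsProbabilityMeasure (reversedLaw p ρ₀) := by
  have := isProbabilityMeasure_jointLaw hp hρ₀
  rw [← map_swap_jointLaw hp hρ₀]
  exact Measure.isProbabilityMeasure_map measurable_swap.aemeasurable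

/-- The identities are only required where `ρ₀` is nonzero, which is exactly where the joint density
determines `p`. -/
lemma ae_refMeasure_iff [SigmaFinite (leb X)] (hρ₀ : IsProbDensity ρ₀) {P : X × X → Prop} :
    (∀ᵐ q ∂(refMeasure ρ₀), P q) ↔ ∀ᵐ q ∂((leb X).prod (leb X)), ρ₀ q.1 ≠ 0 → P q := by
  have h := hρ₀.measurable
  rw [refMeasure, prod_withDensity_left (by fun_prop), ae_withDensity_iff (by fun_prop)]
  simp

/-- The marginal density of `X_t` is `ρ₀`, so cancelling it from the factorized joint density leaves
`p` itself as a function of `(r x, y)`. -/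
lemma lumpable_iff [SigmaFinite (leb X)] [StandardBorelSpace X] [Nonempty X]
    (hp : IsTransitionDensity p) (hρ₀ : IsProbDensity ρ₀) {r : X → E d} (hr : Measurable r)
    [IsFiniteMeasure (jointLaw p ρ₀)] :
    CondFactorsThrough (jointLaw p ρ₀) r ↔ Lumpable p ρ₀ r := by
  have hg := measurable_jointDensity hp hρ₀
  have : IsFiniteMeasure (((leb X).prod (leb X)).withDensity (jointDensity p ρ₀)) :=
    ‹IsFiniteMeasure (jointLaw p ρ₀)›
  constructor
  · intro h
    obtain ⟨f, hf, hfg⟩ := CondFactorsThrough.exists_density_eq hg jointDensity_ne_top hr h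
    refine ⟨f, hf, (ae_refMeasure_iff hρ₀).2 ?_⟩
    filter_upwards [hfg] with q hq h0
    rw [lintegral_jointDensity hp, jointDensity,
      ENNReal.mul_right_inj (by simpa using h0) ENNReal.coe_ne_top] at hq
    exact_mod_cast hq
  · rintro ⟨pL, hpL, h⟩
    rw [ae_refMeasure_iff hρ₀] at h
    refine condFactorsThrough_of_density_eq hg hr (c := fun x => ρ₀ x) (f := fun q => pL q)
      hpL.coe_nnreal_ennreal ?_
    filter_upwards [h] with q hq
    by_cases h0 : ρ₀ q.1 = 0
    · simp [jointDensity, h0]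
    · rw [jointDensity, hq h0]

/-- Bayes' rule: when the backward conditional law factors through `r`, the joint density is `m(y)
f(r(y), x)` with `m` the marginal density of `X_{t+τ}`, and dividing by `ρ₀(x)` gives the two
factors of `p`. -/
lemma decomposable_iff [SigmaFinite (leb X)] [StandardBorelSpace X] [Nonempty X]
    (hp : IsTransitionDensity p) (hρ₀ : IsProbDensity ρ₀) {r : X → E d} (hr : Measurable r)
    [IsFiniteMeasure (reversedLaw p ρ₀)] :
    CondFactorsThrough (reversedLaw p ρ₀) r ↔ Decomposable p ρ₀ r := by
  have hg := measurable_jointDensity hp hρ₀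
  have hgs : Measurable fun q : X × X => jointDensity p ρ₀ q.swap := by fun_prop
  have hρm := hρ₀.measurable
  have hfinite : IsFiniteMeasure
      (((leb X).prod (leb X)).withDensity fun q => jointDensity p ρ₀ q.swap) :=
    ‹IsFiniteMeasure (reversedLaw p ρ₀)›
  have hswap : MeasurePreserving Prod.swap ((leb X).prod (leb X)) ((leb X).prod (leb X)) :=
    Measure.measurePreserving_swap
  constructor
  · intro h
    obtain ⟨f, hf, hfg⟩ :=
      CondFactorsThrough.exists_density_eq hgs (fun q => jointDensity_ne_top _) hr h
    have hm : Measurable fun y => ∫⁻ x, jointDensity p ρ₀ (x, y) ∂(leb X) :=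
      hgs.lintegral_prod_right'
    -- The local factor is the marginal density of `X_{t+τ}` at `y`; it does not need its argument
    -- `r y`. Division by `ρ₀ = 0` only occurs on a null set of the reference measure.
    refine ⟨fun q => f (q.2, q.1) / ρ₀ q.1,
      fun q => (∫⁻ x, jointDensity p ρ₀ (x, q.2) ∂(leb X)).toNNReal, by fun_prop,
      (hm.comp measurable_snd).ennreal_toNNReal, (ae_refMeasure_iff hρ₀).2 ?_⟩
    have hfin : ∀ᵐ q ∂((leb X).prod (leb X)), ∫⁻ x, jointDensity p ρ₀ (x, q.2) ∂(leb X) < ∞ := by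
      refine Measure.quasiMeasurePreserving_snd.ae (ae_lt_top hm ?_)
      have := measure_ne_top (((leb X).prod (leb X)).withDensity
        fun q => jointDensity p ρ₀ q.swap) Set.univ
      rwa [withDensity_apply _ MeasurableSet.univ, setLIntegral_univ,
        lintegral_prod _ hgs.aemeasurable] at this
    filter_upwards [hswap.quasiMeasurePreserving.ae hfg, hfin] with q hq hqfin h0
    simp only [Prod.swap_swap, Prod.fst_swap, Prod.snd_swap, Prod.swap_prod_mk] at hq
    lift ∫⁻ x, jointDensity p ρ₀ (x, q.2) ∂(leb X) to ℝ≥0 using hqfin.ne with m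
    rw [jointDensity] at hq
    norm_cast at hq
    rw [ENNReal.toNNReal_coe, div_mul_eq_mul_div, eq_div_iff h0, mul_comm, hq, mul_comm]
  · rintro ⟨pD, pl, hpD, hpl, h⟩
    rw [ae_refMeasure_iff hρ₀] at h
    refine condFactorsThrough_of_density_eq hgs hr (c := fun y => pl (r y, y))
      (f := fun q => (ρ₀ q.2 : ℝ≥0∞) * pD (q.2, q.1)) (by fun_prop) ?_
    filter_upwards [hswap.quasiMeasurePreserving.ae h] with q hq
    by_cases h0 : ρ₀ q.2 = 0
    · simp [jointDensity, h0]
    · simp only [jointDensity, Prod.fst_swap, Prod.snd_swap] at hq ⊢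
      rw [hq h0]
      push_cast
      ring

lemma loss₀_eq_condLoss (v : ℝ × E D × X → E D) :
    loss₀ p ρ₀ v = condLoss Subtype.val (jointLaw p ρ₀) v := rfl

/-- Exchanging the coordinates turns the backward loss into a forward one, so the conditional theory
applies to both. -/
lemma loss₁_eq_condLoss [SigmaFinite (leb X)] (hp : IsTransitionDensity p)
    (hρ₀ : IsProbDensity ρ₀) {v : ℝ × E D × X → E D} (hv : Measurable v) :
    loss₁ p ρ₀ v = condLoss Subtype.val (reversedLaw p ρ₀) v := by
  have hF := (measurable_condLoss_integrand (B := X) measurable_subtype_coe hv).lintegral_prod_right'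
    (ν := stdGaussian (E D))
  refine lintegral_congr fun s => ?_
  rw [← map_swap_jointLaw hp hρ₀]
  exact (lintegral_map (hF.comp (measurable_prodMk_left (x := s))) measurable_swap).symm

end Main
end FMRC

/-! ### Combining the forward and backward losses. -/

theorem mainTheorem1 {D d : ℕ} (X : Set (EuclideanSpace ℝ (Fin D))) (hX : MeasurableSet X)
    (p : X → X → ℝ≥0) (hp : FMRC.IsTransitionDensity p)
    (ρ₀ : X → ℝ≥0) (hρ₀ : FMRC.IsProbDensity ρ₀)
    (r : X → EuclideanSpace ℝ (Fin d)) (hr : Measurable r) :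
    ∃ m mRC : ℝ≥0∞,
      IsLeast (FMRC.fullLossValues p ρ₀) m ∧
      IsLeast (FMRC.fmrcLossValues p ρ₀ r) mRC ∧
      m ≤ mRC ∧
      (m < ∞ → (mRC = m ↔ FMRC.Lumpable p ρ₀ r ∧ FMRC.Decomposable p ρ₀ r)) := by
  have hσ := FMRC.sigmaFinite_leb hX
  have hSB : StandardBorelSpace X := hX.standardBorel
  have hne : Nonempty X := by
    by_contra hcon
    rw [not_nonempty_iff] at hcon
    have := hρ₀.lintegral_eq_one
    rw [Measure.eq_zero_of_isEmpty (FMRC.leb X), lintegral_zero_measure] at this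
    exact zero_ne_one this
  have hP := FMRC.isProbabilityMeasure_jointLaw hp hρ₀
  have hP' := FMRC.isProbabilityMeasure_reversedLaw hp hρ₀
  have hι := MeasurableEmbedding.subtype_coe hX
  obtain ⟨v₀, u₀, hv₀, hu₀, hvmin₀, humin₀, hiff₀⟩ :=
    FMRC.exists_condLoss_minimizers hι (FMRC.jointLaw p ρ₀) hr
  obtain ⟨v₁, u₁, hv₁, hu₁, hvmin₁, humin₁, hiff₁⟩ :=
    FMRC.exists_condLoss_minimizers hι (FMRC.reversedLaw p ρ₀) hr
  rw [FMRC.lumpable_iff hp hρ₀ hr] at hiff₀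
  rw [FMRC.decomposable_iff hp hρ₀ hr] at hiff₁
  have hb : ∀ {u : ℝ × FMRC.E D × FMRC.E d → FMRC.E D}, Measurable u →
      Measurable (FMRC.bottleneck r u) := fun hu =>
    hu.comp (f := fun x : ℝ × FMRC.E D × X => (x.1, x.2.1, r x.2.2)) (by fun_prop)
  have hloss₁ : ∀ {v : ℝ × FMRC.E D × X → FMRC.E D}, Measurable v → FMRC.loss₁ p ρ₀ v
      = FMRC.condLoss Subtype.val (FMRC.reversedLaw p ρ₀) v := fun hv =>
    FMRC.loss₁_eq_condLoss hp hρ₀ hv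
  simp only [← FMRC.loss₀_eq_condLoss] at hvmin₀ humin₀ hiff₀
  have hle₀ : FMRC.loss₀ p ρ₀ v₀ ≤ FMRC.loss₀ p ρ₀ (FMRC.bottleneck r u₀) := hvmin₀ _ (hb hu₀)
  have hle₁ : FMRC.loss₁ p ρ₀ v₁ ≤ FMRC.loss₁ p ρ₀ (FMRC.bottleneck r u₁) := by
    rw [hloss₁ hv₁, hloss₁ (hb hu₁)]
    exact hvmin₁ _ (hb hu₁)
  refine ⟨FMRC.fullLoss p ρ₀ v₀ v₁, FMRC.fmrcLoss p ρ₀ r u₀ u₁, ⟨⟨v₀, v₁, hv₀, hv₁, rfl⟩, ?_⟩,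
    ⟨⟨u₀, u₁, hu₀, hu₁, rfl⟩, ?_⟩, add_le_add hle₀ hle₁, fun hfin => ?_⟩
  · rintro l ⟨w₀, w₁, hw₀, hw₁, rfl⟩
    refine add_le_add (hvmin₀ w₀ hw₀) ?_
    rw [hloss₁ hv₁, hloss₁ hw₁]
    exact hvmin₁ w₁ hw₁
  · rintro l ⟨w₀, w₁, hw₀, hw₁, rfl⟩
    refine add_le_add (humin₀ w₀ hw₀) ?_
    rw [hloss₁ (hb hu₁), hloss₁ (hb hw₁)]
    exact humin₁ w₁ hw₁
  · obtain ⟨hfin₀, hfin₁⟩ := ENNReal.add_lt_top.1 hfin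
    have h₀ := hiff₀ hfin₀
    have h₁ := hiff₁ (by rwa [← hloss₁ hv₁])
    rw [← hloss₁ hv₁] at h₁
    change FMRC.loss₀ p ρ₀ (FMRC.bottleneck r u₀) = _ ↔ _ at h₀
    change FMRC.condLoss Subtype.val (FMRC.reversedLaw p ρ₀) (FMRC.bottleneck r u₁) = _ ↔ _ at h₁
    rw [← hloss₁ (hb hu₁)] at h₁
    rw [← h₀, ← h₁, FMRC.fmrcLoss, FMRC.fullLoss]
    refine ⟨fun h => ?_, fun h => by rw [h.1, h.2]⟩
    -- Each bottlenecked minimum dominates its unrestricted counterpart, so equality of the finite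
    -- sums forces equality of both summands.
    have heq₀ : FMRC.loss₀ p ρ₀ (FMRC.bottleneck r u₀) = FMRC.loss₀ p ρ₀ v₀ := by
      refine le_antisymm ?_ hle₀
      refine (ENNReal.add_le_add_iff_right hfin₁.ne).1 ?_
      exact (add_le_add le_rfl hle₁).trans h.le
    refine ⟨heq₀, ?_⟩
    rw [heq₀] at h
    exact (ENNReal.add_right_inj hfin₀.ne).1 h
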